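/- Online isotonic regression with squared loss over $T\ge 1$ linearly ordered points $1<2<\dots<T$ (known to the learner in advance) proceeds as follows. In each trial $t=1,\dots,T$ the adversary chooses an index $i_t\in\{1,\dots,T\}\setminus\{i_1,\dots,i_{t-1}\}$; the learner, knowing $i_1,\dots,i_t$ and the labels revealed so far, predicts $\widehat y_{i_t}\in[0,1]$; then the adversary reveals the label $y_{i_t}\in[0,1]$, and the learner suffers the loss $(y_{i_t}-\widehat y_{i_t})^2$. The regret is \[ \mathrm{Reg}_T=\sum_{t=1}^T (y_{i_t}-\widehat y_{i_t})^2-\min_{0\le f_1\le\dots\le f_T\le 1}\ \sum_{j=1}^T (y_j-f_j)^2 . \] Theorem. Every online algorithm suffers worst-case regret $\Omega(T^{1/3})$: there is a universal constant $c>0$ such that for every $T\ge 1$ and every deterministic learner there are an order $(i_1,\dots,i_T)$, a permutation of $\{1,\dots,T\}$, and labels $y_1,\dots,y_T\in[0,1]$ for which \[ \mathrm{Reg}_T\ \ge\ c\,T^{1/3}. \] The same holds, with the same constant, for every randomized learner, with $\mathbb E[\mathrm{Reg}_T]$ in place of $\mathrm{Reg}_T$, where the expectation is over the learner's randomness and the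 order and the labels are fixed before the learner's random choices are made. -/

import Mathlib

open scoped unitInterval

namespace OnlineIsotonic

/-- A (deterministic) online learner for `T` linearly ordered points `0 < 1 < ... < T - 1`.
The horizon and the points are known in advance. In round `t` the learner is given the points
queried in the earlier rounds together with their revealed labels, and the point queried now, and
it predicts a value in `[0, 1]`. (Its own earlier predictions are functions of the same data.) -/
def Learner (T : ℕ) : Type :=
  (t : Fin T) → (Fin t.val → Fin T × I) → Fin T → I

/-- The earlier round `s < t`, as one of the `T` rounds. -/
def earlier {T : ℕ} (t : Fin T) (s : Fin t.val) : Fin T :=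
  ⟨s.val, s.isLt.trans t.isLt⟩

/-- The prediction of the learner `A` in round `t`, when the point `i t` is queried in round `t`
and the point `j` has the label `y j`. It depends on the labels revealed before round `t` only. -/
def prediction {T : ℕ} (A : Learner T) (i : Equiv.Perm (Fin T)) (y : Fin T → I) (t : Fin T) : I :=
  A t (fun s => (i (earlier t s), y (i (earlier t s)))) (i t)

/-- The cumulative squared loss of the learner. -/
noncomputable def learnerLoss {T : ℕ} (A : Learner T) (i : Equiv.Perm (Fin T))
    (y : Fin T → I) : ℝ :=
  ∑ t : Fin T, ((y (i t) : ℝ) - (prediction A i y t : ℝ)) ^ 2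

/-- The isotonic functions with values in `[0, 1]` on the `T` points. -/
def isotonicFunctions (T : ℕ) : Set (Fin T → ℝ) :=
  {f | Monotone f ∧ ∀ j, f j ∈ Set.Icc (0 : ℝ) 1}

/-- The cumulative squared loss of a fixed function `f`. -/
noncomputable def functionLoss {T : ℕ} (f : Fin T → ℝ) (y : Fin T → I) : ℝ :=
  ∑ j : Fin T, ((y j : ℝ) - f j) ^ 2

/-- The loss of the best isotonic function in hindsight. (The infimum is over a nonempty set of
nonnegative numbers and is attained.) -/
noncomputable def bestLoss {T : ℕ} (y : Fin T → I) : ℝ :=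
  sInf ((fun f => functionLoss f y) '' isotonicFunctions T)

/-- The regret of the learner when the points are queried in the order `i` and labelled by `y`. -/
noncomputable def regret {T : ℕ} (A : Learner T) (i : Equiv.Perm (Fin T)) (y : Fin T → I) : ℝ :=
  learnerLoss A i y - bestLoss y

end OnlineIsotonic

namespace OnlineIsotonic

/-! The labels are random and the points are queried from left to right. With `r` of order `T ^ (1 /
3)`, each of the first `r` blocks of `r ^ 2` points has labels centre ± 1/4 with fair independent
signs, and the centres increase by `1 / (4 * r)`. A prediction cannot depend on the sign about to be
revealed, so each such point costs the learner at least the variance 1/16 on average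
(`sum_sgn_mul_eq_zero`). Moving the centre of a block by `1 / (8 * r)` towards the majority sign
keeps the function isotonic (`comparator_mem`) and saves `|S| / (16 * r) - 1 / 64`, where `S` is the
sum of the signs in the block. As `|S|` has mean at least `9 * r / 16` (`le_sum_abs_signSum`), the
mean regret is at least `9 / 256 - 1 / 64 = 5 / 256` per block. -/

/-- The real number `1` or `-1` encoded by a Boolean. -/
def sgn (b : Bool) : ℝ := if b then 1 else -1

lemma sgn_sq (b : Bool) : sgn b ^ 2 = 1 := by
  cases b <;> simp [sgn]

lemma sgn_not (b : Bool) : sgn (!b) = -sgn b := by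
  cases b <;> simp [sgn]

/-! ### Moments of sums of random signs -/

section Signs

variable {ι : Type*} [DecidableEq ι]

/-- The sum of the signs over a finite set. -/
def signSum (B : Finset ι) (ε : ι → Bool) : ℝ := ∑ j ∈ B, sgn (ε j)

lemma signSum_update {B : Finset ι} {j : ι} (hj : j ∉ B) (ε : ι → Bool) (b : Bool) :
    signSum B (Function.update ε j b) = signSum B ε := by
  refine Finset.sum_congr rfl fun i hi => ?_
  rw [Function.update_of_ne (ne_of_mem_of_not_mem hi hj)]

lemma signSum_insert {B : Finset ι} {j : ι} (hj : j ∉ B) (ε : ι → Bool) :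
    signSum (insert j B) ε = sgn (ε j) + signSum B ε :=
  Finset.sum_insert hj

variable [Fintype ι]

/-- A function of the signs that does not depend on the sign `j` is uncorrelated with it. -/
lemma sum_sgn_mul_eq_zero (j : ι) (g : (ι → Bool) → ℝ)
    (hg : ∀ ε b, g (Function.update ε j b) = g ε) :
    ∑ ε : ι → Bool, sgn (ε j) * g ε = 0 := by
  refine Finset.sum_involution (fun ε _ => Function.update ε j (!ε j)) ?_ ?_ ?_ ?_
  · intro ε _
    rw [hg]
    simp [sgn_not]
  · intro ε _ _ h
    have := congrFun h j
    simp at this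
  · intro ε _
    exact Finset.mem_univ _
  · intro ε _
    simp

lemma sum_signSum_sq (B : Finset ι) :
    ∑ ε : ι → Bool, signSum B ε ^ 2 = 2 ^ Fintype.card ι * (B.card : ℝ) := by
  induction B using Finset.induction_on with
  | empty => simp [signSum]
  | insert j B hj ih =>
    have h0 := sum_sgn_mul_eq_zero j (fun ε => 2 * signSum B ε)
      (fun ε b => by rw [signSum_update hj])
    have h1 : ∀ ε : ι → Bool, signSum (insert j B) ε ^ 2
        = 1 + sgn (ε j) * (2 * signSum B ε) + signSum B ε ^ 2 := by
      intro ε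
      rw [signSum_insert hj]
      linear_combination sgn_sq (ε j)
    simp_rw [h1, Finset.sum_add_distrib]
    rw [h0, ih, Finset.card_insert_of_notMem hj]
    simp
    ring

/-- The odd cross terms vanish, so a new sign adds `1 + 6 * B.card` to the fourth moment, less than
the increment of `3 * B.card ^ 2`. -/
lemma sum_signSum_pow_four_le (B : Finset ι) :
    ∑ ε : ι → Bool, signSum B ε ^ 4 ≤ 2 ^ Fintype.card ι * (3 * (B.card : ℝ) ^ 2) := by
  induction B using Finset.induction_on with
  | empty => simp [signSum]
  | insert j B hj ih =>
    have h0 := sum_sgn_mul_eq_zero j (fun ε => 4 * signSum B ε ^ 3 + 4 * signSum B ε)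
      (fun ε b => by rw [signSum_update hj])
    have h1 : ∀ ε : ι → Bool, signSum (insert j B) ε ^ 4
        = 1 + sgn (ε j) * (4 * signSum B ε ^ 3 + 4 * signSum B ε)
          + 6 * signSum B ε ^ 2 + signSum B ε ^ 4 := by
      intro ε
      rw [signSum_insert hj]
      linear_combination (6 * signSum B ε ^ 2 + 4 * sgn (ε j) * signSum B ε
        + sgn (ε j) ^ 2 + 1) * sgn_sq (ε j)
    simp_rw [h1, Finset.sum_add_distrib, ← Finset.mul_sum]
    rw [h0, sum_signSum_sq, Finset.card_insert_of_notMem hj]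
    simp
    have : (0 : ℝ) < 2 ^ Fintype.card ι := by positivity
    nlinarith

/-- A Khintchine inequality: the mean absolute value of a sum of `r ^ 2` signs is of order `r`. -/
lemma le_sum_abs_signSum (B : Finset ι) {r : ℕ} (hB : B.card = r ^ 2) :
    2 ^ Fintype.card ι * (9 / 16 * (r : ℝ)) ≤ ∑ ε : ι → Bool, |signSum B ε| := by
  rcases Nat.eq_zero_or_pos r with rfl | hr
  · simpa using Finset.sum_nonneg fun ε _ => abs_nonneg (signSum B ε)
  have hr' : (0 : ℝ) < r := by exact_mod_cast hr
  -- The two sides agree to second order at `|S| = 2 * r`; averaging gives `(12 - 3) * r ^ 4 / (16 *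
  -- r ^ 3) = 9 / 16 * r`.
  have key : ∀ ε : ι → Bool,
      12 * (r : ℝ) ^ 2 * signSum B ε ^ 2 - signSum B ε ^ 4 ≤ 16 * (r : ℝ) ^ 3 * |signSum B ε| := by
    intro ε
    have hx := abs_nonneg (signSum B ε)
    rw [← sq_abs (signSum B ε), show signSum B ε ^ 4 = |signSum B ε| ^ 4 by
      rw [← (show Even 4 by decide).pow_abs]]
    generalize |signSum B ε| = x at hx
    have : 0 ≤ x * ((2 * r - x) ^ 2 * (x + 4 * r)) := by positivity
    linarith [this, show x * ((2 * r - x) ^ 2 * (x + 4 * r))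
      = 16 * (r : ℝ) ^ 3 * x - (12 * (r : ℝ) ^ 2 * x ^ 2 - x ^ 4) by ring]
  have hsum := Finset.sum_le_sum fun ε (_ : ε ∈ Finset.univ) => key ε
  rw [Finset.sum_sub_distrib, ← Finset.mul_sum, ← Finset.mul_sum, sum_signSum_sq] at hsum
  have h4 := sum_signSum_pow_four_le B
  rw [hB] at h4 hsum
  push_cast at h4 hsum
  refine le_of_mul_le_mul_left ?_ (show (0 : ℝ) < 16 * (r : ℝ) ^ 3 by positivity)
  linarith

end Signs

/-! ### The random labels and the comparator -/

section HardLabels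

variable {T : ℕ} (r : ℕ)

/-- The number of the block of `r ^ 2` consecutive points that contains `j`. -/
def block (j : Fin T) : ℕ := j.val / r ^ 2

/-- The centre of the labels in the block `k`. -/
noncomputable def center (k : ℕ) : ℝ := 1 / 4 + k / (4 * r)

lemma center_add_le {k : ℕ} (hk : k < r) : center r k + 1 / (4 * r) ≤ 1 / 2 := by
  have hr : (0 : ℝ) < r := by exact_mod_cast (Nat.zero_le k).trans_lt hk
  have hk' : (k : ℝ) + 1 ≤ r := by exact_mod_cast hk
  have : ((k : ℝ) + 1) / (4 * r) ≤ 1 / 4 := by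
    rw [div_le_iff₀ (by positivity)]
    linarith
  rw [add_div] at this
  unfold center
  linarith

lemma le_center (k : ℕ) : 1 / 4 ≤ center r k := by
  unfold center
  have : (0 : ℝ) ≤ k / (4 * r) := by positivity
  linarith

lemma center_le_half {k : ℕ} (hk : k < r) : center r k ≤ 1 / 2 := by
  have : (0 : ℝ) ≤ 1 / (4 * r) := by positivity
  linarith [center_add_le r hk]

/-- Random labels: fair and independent around the centre of the block, and `1` behind the first
`r` blocks. -/
noncomputable def hardLabel (ε : Fin T → Bool) (j : Fin T) : unitInterval :=
  if h : block r j < r then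
    ⟨center r (block r j) + sgn (ε j) / 4, by
      have h1 := le_center r (block r j)
      have h2 := center_le_half r h
      cases ε j <;> simp only [sgn] <;> constructor <;> norm_num <;> linarith⟩
  else 1

lemma hardLabel_of_lt (ε : Fin T → Bool) {j : Fin T} (h : block r j < r) :
    (hardLabel r ε j : ℝ) = center r (block r j) + sgn (ε j) / 4 := by
  rw [hardLabel, dif_pos h]

lemma hardLabel_of_le (ε : Fin T → Bool) {j : Fin T} (h : ¬ block r j < r) :
    (hardLabel r ε j : ℝ) = 1 := by
  rw [hardLabel, dif_neg h, Set.Icc.coe_one]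

lemma hardLabel_update (ε : Fin T → Bool) {j t : Fin T} (h : j ≠ t) (b : Bool) :
    hardLabel r (Function.update ε t b) j = hardLabel r ε j := by
  unfold hardLabel
  simp only [Function.update_of_ne h]

/-- The points of the block `k`. -/
def blockSet (T r k : ℕ) : Finset (Fin T) := {j | block r j = k}

lemma mem_blockSet {k : ℕ} {j : Fin T} : j ∈ blockSet T r k ↔ block r j = k := by
  simp [blockSet]

lemma card_blockSet {k : ℕ} (hr : 0 < r) (hk : k < r) (hT : r ^ 3 ≤ T) :
    (blockSet T r k).card = r ^ 2 := by
  have hr2 : 0 < r ^ 2 := by positivity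
  have : (blockSet T r k).map Fin.valEmbedding = Finset.Ico (k * r ^ 2) ((k + 1) * r ^ 2) := by
    have hiff : ∀ x, x / r ^ 2 = k ↔ k * r ^ 2 ≤ x ∧ x < (k + 1) * r ^ 2 := fun x => by
      rw [← Nat.le_div_iff_mul_le hr2, ← Nat.div_lt_iff_lt_mul hr2]
      omega
    ext x
    simp only [Finset.mem_map, Fin.valEmbedding_apply, Finset.mem_Ico, ← hiff]
    constructor
    · rintro ⟨j, hj, rfl⟩
      exact (mem_blockSet r).1 hj
    · intro hx
      -- The first `r` blocks fill `r ^ 3 ≤ T` points, so none is cut short.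
      have hlt : x < T := by
        have : (k + 1) * r ^ 2 ≤ r * r ^ 2 := Nat.mul_le_mul_right _ hk
        have := ((hiff x).1 hx).2
        nlinarith
      exact ⟨⟨x, hlt⟩, (mem_blockSet r).2 hx, rfl⟩
  rw [← Finset.card_map Fin.valEmbedding, this, Nat.card_Ico, ← Nat.sub_mul]
  simp

/-- The sign of the sum of the signs in the block `k`. -/
noncomputable def blockSign (ε : Fin T → Bool) (k : ℕ) : ℝ :=
  if 0 ≤ signSum (blockSet T r k) ε then 1 else -1

lemma blockSign_mul (ε : Fin T → Bool) (k : ℕ) :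
    blockSign r ε k * signSum (blockSet T r k) ε = |signSum (blockSet T r k) ε| := by
  unfold blockSign
  split_ifs with h
  · rw [abs_of_nonneg h, one_mul]
  · rw [abs_of_neg (not_le.1 h)]
    ring

lemma blockSign_sq (ε : Fin T → Bool) (k : ℕ) : blockSign r ε k ^ 2 = 1 := by
  unfold blockSign
  split_ifs <;> norm_num

lemma abs_blockSign (ε : Fin T → Bool) (k : ℕ) : |blockSign r ε k| = 1 := by
  unfold blockSign
  split_ifs <;> norm_num

/-- An isotonic function that follows the majority of the signs in each block. -/
noncomputable def comparator (ε : Fin T → Bool) (j : Fin T) : ℝ :=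
  if block r j < r then center r (block r j) + blockSign r ε (block r j) / (8 * r) else 1

lemma abs_blockSign_div (ε : Fin T → Bool) (k : ℕ) :
    |blockSign r ε k / (8 * r)| = 1 / (8 * r) := by
  rw [abs_div, abs_blockSign, abs_of_nonneg (by positivity)]

/-- Opposite shifts of two neighbouring blocks add up to exactly the gap `1 / (4 * r)` between their
centres, so the values may meet but never cross. -/
lemma comparator_mem (ε : Fin T → Bool) : comparator r ε ∈ isotonicFunctions T := by
  have hup : ∀ k < r, center r k + blockSign r ε k / (8 * r) ≤ 1 := by
    intro k hk
    have h1 := le_of_abs_le (abs_blockSign_div r ε k).le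
    have h2 := center_add_le r hk
    have h3 : (1 : ℝ) / (8 * r) ≤ 1 / (4 * r) := by
      have hr : (0 : ℝ) < r := by exact_mod_cast (Nat.zero_le k).trans_lt hk
      gcongr
      norm_num
    linarith
  constructor
  · intro i j hij
    have hb : block r i ≤ block r j := Nat.div_le_div_right hij
    unfold comparator
    by_cases hj : block r j < r
    · rw [if_pos hj, if_pos (hb.trans_lt hj)]
      rcases hb.eq_or_lt with h | h
      · rw [h]
      · have h1 := le_of_abs_le (abs_blockSign_div r ε (block r i)).le
        have h2 := neg_le_of_abs_le (abs_blockSign_div r ε (block r j)).le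
        have h3 : center r (block r i) + 1 / (4 * r) ≤ center r (block r j) := by
          have : (block r i : ℝ) + 1 ≤ block r j := by exact_mod_cast h
          unfold center
          rw [add_assoc, ← add_div]
          gcongr
        have h4 : (1 : ℝ) / (8 * r) + 1 / (8 * r) = 1 / (4 * r) := by
          field_simp
          norm_num
        linarith
    · rw [if_neg hj]
      split_ifs with hi
      · exact hup _ hi
      · exact le_rfl
  · intro j
    unfold comparator
    split_ifs with h
    · refine ⟨?_, hup _ h⟩
      have hr : (1 : ℝ) ≤ r := by exact_mod_cast (Nat.zero_le _).trans_lt h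
      have h1 := neg_le_of_abs_le (abs_blockSign_div r ε (block r j)).le
      have h2 : (1 : ℝ) / (8 * r) ≤ 1 / 4 := by
        rw [div_le_div_iff₀ (by positivity) (by norm_num)]
        linarith
      linarith [le_center r (block r j)]
    · simp

lemma bestLoss_le (f : Fin T → ℝ) (hf : f ∈ isotonicFunctions T) (y : Fin T → unitInterval) :
    bestLoss y ≤ functionLoss f y := by
  refine csInf_le ⟨0, ?_⟩ ⟨f, hf, rfl⟩
  rintro _ ⟨g, _, rfl⟩
  exact Finset.sum_nonneg fun j _ => sq_nonneg _

/-- The variance of the random label of the point `j`. -/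
noncomputable def labelVariance (j : Fin T) : ℝ := if block r j < r then 1 / 16 else 0

lemma sum_sum_blockSet (g : Fin T → ℝ) :
    ∑ k ∈ Finset.range r, ∑ j ∈ blockSet T r k, g j = ∑ j, if block r j < r then g j else 0 := by
  rw [← Finset.sum_filter, ← Finset.sum_fiberwise_of_maps_to (t := Finset.range r) (g := block r)
    (fun j hj => by simpa using hj)]
  refine Finset.sum_congr rfl fun k hk => Finset.sum_congr ?_ fun _ _ => rfl
  ext j
  simp only [mem_blockSet, Finset.mem_filter, Finset.mem_univ, true_and]
  exact ⟨fun h => ⟨h ▸ Finset.mem_range.1 hk, h⟩, fun h => h.2⟩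

lemma functionLoss_comparator (hr : 0 < r) (hT : r ^ 3 ≤ T) (ε : Fin T → Bool) :
    functionLoss (comparator r ε) (hardLabel r ε)
      = ∑ j : Fin T, labelVariance r j
        - ∑ k ∈ Finset.range r, (|signSum (blockSet T r k) ε| / (16 * r) - 1 / 64) := by
  have hr' : (r : ℝ) ≠ 0 := by exact_mod_cast hr.ne'
  have hk : ∀ k ∈ Finset.range r, |signSum (blockSet T r k) ε| / (16 * r) - 1 / 64
      = ∑ j ∈ blockSet T r k,
        (blockSign r ε (block r j) * sgn (ε j) / (16 * r) - 1 / (64 * (r : ℝ) ^ 2)) := by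
    intro k hk
    rw [Finset.sum_sub_distrib, ← Finset.sum_div, Finset.sum_const,
      card_blockSet r hr (Finset.mem_range.1 hk) hT, ← blockSign_mul]
    congr 1
    · rw [signSum, Finset.mul_sum]
      congr 1
      refine Finset.sum_congr rfl fun j hj => ?_
      rw [(mem_blockSet r).1 hj]
    · simp
      field_simp
  rw [Finset.sum_congr rfl hk, sum_sum_blockSet, ← Finset.sum_sub_distrib]
  refine Finset.sum_congr rfl fun j _ => ?_
  unfold comparator labelVariance
  split_ifs with h
  · rw [hardLabel_of_lt r ε h]
    have h1 := sgn_sq (ε j)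
    have h2 := blockSign_sq r ε (block r j)
    linear_combination 1 / 16 * h1 + 1 / (64 * (r : ℝ) ^ 2) * h2
  · simp [hardLabel_of_le r ε h]

lemma le_sum_regret (A : Learner T) (hr : 0 < r) (hT : r ^ 3 ≤ T) :
    2 ^ T * (5 / 256 * (r : ℝ)) ≤ ∑ ε : Fin T → Bool, regret A 1 (hardLabel r ε) := by
  have hr' : (0 : ℝ) < r := by exact_mod_cast hr
  have hlearn : ∑ ε : Fin T → Bool, ∑ j : Fin T, labelVariance r j
      ≤ ∑ ε : Fin T → Bool, learnerLoss A 1 (hardLabel r ε) := by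
    unfold learnerLoss
    rw [Finset.sum_comm, Finset.sum_comm (s := Finset.univ) (t := Finset.univ (α := Fin T))]
    refine Finset.sum_le_sum fun t _ => ?_
    by_cases h : block r t < r
    -- Only labels of points other than `t` have been revealed, so flipping the sign at `t` leaves
    -- the prediction unchanged.
    · have hpred : ∀ ε b, prediction A 1 (hardLabel r (Function.update ε t b)) t
          = prediction A 1 (hardLabel r ε) t := by
        intro ε b
        unfold prediction
        congr 1
        funext s
        have hne : earlier t s ≠ t := fun h => s.isLt.ne (congrArg Fin.val h)
        simp only [Equiv.Perm.coe_one, id, hardLabel_update r ε hne]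
      -- This is the cross term in the square of (centre − prediction) + sign / 4.
      have h0 := sum_sgn_mul_eq_zero t
        (fun ε => (center r (block r t) - prediction A 1 (hardLabel r ε) t) / 2)
        (fun ε b => by rw [hpred])
      rw [← add_zero (∑ ε : Fin T → Bool, labelVariance r t), ← h0, ← Finset.sum_add_distrib]
      refine Finset.sum_le_sum fun ε _ => ?_
      rw [labelVariance, if_pos h, Equiv.Perm.coe_one, id, hardLabel_of_lt r ε h]
      nlinarith [sgn_sq (ε t),
        sq_nonneg (center r (block r t) - (prediction A 1 (hardLabel r ε) t : ℝ))]
    · refine Finset.sum_le_sum fun ε _ => ?_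
      rw [labelVariance, if_neg h]
      exact sq_nonneg _
  have hbest : ∀ ε : Fin T → Bool, bestLoss (hardLabel r ε) ≤ ∑ j : Fin T, labelVariance r j
        - ∑ k ∈ Finset.range r, (|signSum (blockSet T r k) ε| / (16 * r) - 1 / 64) := fun ε =>
    (bestLoss_le _ (comparator_mem r ε) _).trans_eq (functionLoss_comparator r hr hT ε)
  have hsum := Finset.sum_le_sum fun ε (_ : ε ∈ Finset.univ) => hbest ε
  rw [Finset.sum_sub_distrib, Finset.sum_comm (t := Finset.range r)] at hsum
  have hblock : ∀ k ∈ Finset.range r, 2 ^ T * (5 / 256 : ℝ)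
      ≤ ∑ ε : Fin T → Bool, (|signSum (blockSet T r k) ε| / (16 * r) - 1 / 64) := by
    intro k hk
    have := le_sum_abs_signSum (blockSet T r k) (card_blockSet r hr (Finset.mem_range.1 hk) hT)
    rw [Finset.sum_sub_distrib, ← Finset.sum_div]
    have h2 := div_le_div_of_nonneg_right this (show (0 : ℝ) ≤ 16 * r by positivity)
    have h3 : 2 ^ Fintype.card (Fin T) * (9 / 16 * (r : ℝ)) / (16 * r) = 2 ^ T * (9 / 256) := by
      rw [Fintype.card_fin]
      field_simp
      norm_num
    rw [h3] at h2
    simp at h2 ⊢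
    linarith
  have htotal := Finset.sum_le_sum hblock
  rw [Finset.sum_const, Finset.card_range, nsmul_eq_mul] at htotal
  unfold regret
  rw [Finset.sum_sub_distrib]
  linarith

end HardLabels

/-! ### Randomized learners and the final constant -/

lemma integrable_regret {T : ℕ} {Ω : Type*} [MeasurableSpace Ω] (μ : MeasureTheory.Measure Ω)
    [MeasureTheory.IsProbabilityMeasure μ] (A : Ω → Learner T)
    (hA : ∀ (t : Fin T) (past : Fin t.val → Fin T × unitInterval) (j : Fin T),
      Measurable fun ω => A ω t past j) (i : Equiv.Perm (Fin T)) (y : Fin T → unitInterval) :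
    MeasureTheory.Integrable (fun ω => regret (A ω) i y) μ := by
  unfold regret learnerLoss
  refine MeasureTheory.Integrable.sub ?_ (MeasureTheory.integrable_const _)
  refine MeasureTheory.integrable_finsetSum _ fun t _ => ?_
  have hm : Measurable fun ω => (prediction (A ω) i y t : ℝ) :=
    measurable_subtype_coe.comp (hA t _ _)
  refine MeasureTheory.Integrable.of_bound
    ((measurable_const.sub hm).pow_const 2).aestronglyMeasurable 1 (.of_forall fun ω => ?_)
  rw [Real.norm_eq_abs, abs_of_nonneg (sq_nonneg _), sq_le_one_iff_abs_le_one, abs_le]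
  have h1 := (y (i t)).2
  have h2 := (prediction (A ω) i y t).2
  constructor <;> linarith [h1.1, h1.2, h2.1, h2.2]

/-- If the total of `g` over all sign vectors is at least `2 ^ T * b`, then some value of `g` is
at least `b`. -/
lemma exists_le_of_le_sum_signs {T : ℕ} {b : ℝ} {g : (Fin T → Bool) → ℝ}
    (h : 2 ^ T * b ≤ ∑ ε, g ε) : ∃ ε, b ≤ g ε := by
  obtain ⟨ε, _, hε⟩ := Finset.exists_le_of_sum_le (s := Finset.univ) (f := fun _ => b) (g := g)
    Finset.univ_nonempty (by simpa using h)
  exact ⟨ε, hε⟩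

/-- The integer part of the cube root, up to a factor `2`. -/
lemma exists_cube_le (T : ℕ) (hT : 1 ≤ T) :
    ∃ r : ℕ, 0 < r ∧ r ^ 3 ≤ T ∧ (T : ℝ) ^ ((1 : ℝ) / 3) ≤ 2 * r := by
  have hx : (1 : ℝ) ≤ (T : ℝ) ^ ((1 : ℝ) / 3) :=
    Real.one_le_rpow (by exact_mod_cast hT) (by norm_num)
  have hcube : ((T : ℝ) ^ ((1 : ℝ) / 3)) ^ 3 = T := by
    rw [← Real.rpow_natCast, ← Real.rpow_mul (Nat.cast_nonneg T)]
    norm_num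
  have hpos : 0 < ⌊(T : ℝ) ^ ((1 : ℝ) / 3)⌋₊ := Nat.floor_pos.2 hx
  refine ⟨_, hpos, ?_, ?_⟩
  · have := pow_le_pow_left₀ (Nat.cast_nonneg _) (Nat.floor_le (zero_le_one.trans hx)) 3
    rw [hcube] at this
    exact_mod_cast this
  · have h1 := Nat.lt_floor_add_one ((T : ℝ) ^ ((1 : ℝ) / 3))
    have h2 : (1 : ℝ) ≤ ⌊(T : ℝ) ^ ((1 : ℝ) / 3)⌋₊ := by exact_mod_cast hpos
    linarith

end OnlineIsotonic

/-- Every learner, deterministic or randomized, has worst-case (expected) regret at least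
`c * T ^ (1 / 3)`, where `c > 0` is a universal constant. A randomized learner is a random element
`A` of the set of deterministic learners; the order and the labels do not depend on its
random choices. -/
theorem theorem5 :
    ∃ c : ℝ, 0 < c ∧ ∀ T : ℕ, 1 ≤ T →
      (∀ A : OnlineIsotonic.Learner T,
        ∃ (i : Equiv.Perm (Fin T)) (y : Fin T → unitInterval),
          c * (T : ℝ) ^ ((1 : ℝ) / 3) ≤ OnlineIsotonic.regret A i y) ∧
      (∀ (Ω : Type*) [MeasurableSpace Ω] (μ : MeasureTheory.Measure Ω)
        [MeasureTheory.IsProbabilityMeasure μ] (A : Ω → OnlineIsotonic.Learner T),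
        (∀ (t : Fin T) (past : Fin t.val → Fin T × unitInterval) (j : Fin T),
          Measurable fun ω => A ω t past j) →
        ∃ (i : Equiv.Perm (Fin T)) (y : Fin T → unitInterval),
          c * (T : ℝ) ^ ((1 : ℝ) / 3) ≤ ∫ ω, OnlineIsotonic.regret (A ω) i y ∂μ) := by
  -- Half of 5/256, because `T ^ (1 / 3) ≤ 2 * r`.
  refine ⟨5 / 512, by norm_num, fun T hT => ?_⟩
  obtain ⟨r, hr, hrT, hroot⟩ := OnlineIsotonic.exists_cube_le T hT
  have hc : 5 / 512 * (T : ℝ) ^ ((1 : ℝ) / 3) ≤ 5 / 256 * r := by linarith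
  constructor
  · intro A
    obtain ⟨ε, hε⟩ :=
      OnlineIsotonic.exists_le_of_le_sum_signs (OnlineIsotonic.le_sum_regret r A hr hrT)
    exact ⟨1, OnlineIsotonic.hardLabel r ε, hc.trans hε⟩
  · intro Ω _ μ _ A hA
    have hint := fun ε : Fin T → Bool =>
      OnlineIsotonic.integrable_regret μ A hA 1 (OnlineIsotonic.hardLabel r ε)
    -- The bound on the sum over `ε` holds for every `ω`. Integrating it before `ε` is chosen yields
    -- labels that do not depend on `ω`.
    have hsum : 2 ^ T * (5 / 256 * (r : ℝ)) ≤ ∑ ε : Fin T → Bool,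
        ∫ ω, OnlineIsotonic.regret (A ω) 1 (OnlineIsotonic.hardLabel r ε) ∂μ := by
      rw [← MeasureTheory.integral_finsetSum _ fun ε _ => hint ε]
      have := MeasureTheory.integral_mono
        (MeasureTheory.integrable_const (μ := μ) (2 ^ T * (5 / 256 * (r : ℝ))))
        (MeasureTheory.integrable_finsetSum Finset.univ fun ε _ => hint ε)
        fun ω => OnlineIsotonic.le_sum_regret r (A ω) hr hrT
      simpa using this
    obtain ⟨ε, hε⟩ := OnlineIsotonic.exists_le_of_le_sum_signs hsum
    exact ⟨1, OnlineIsotonic.hardLabel r ε, hc.trans hε⟩
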